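/- **Setting.** An instance consists of a finite set $C$ of clients, a finite set $S$ of servers, a bipartite graph with edge set $E\subseteq C\times S$ in which every client has at least one incident edge, and positive integer weights $w(c)$, $c\in C$. Put $n=|C|+|S|$ and $m=|E|$. An *assignment* is a set $A\subseteq E$ containing exactly one edge at every client; its load vector is $L_A(s)=\sum_{c:\,cs\in A}w(c)$. For $z:E\to\mathbb R_{\ge 0}$ put $L_z(s)=\sum_{c:\,cs\in E}w(c)z(cs)$ and $z(\delta(c))=\sum_{s:\,cs\in E}z(cs)$. For real $p\ge 1$ let $\mathrm{OPT}_p=\min_A\|L_A\|_p$ over all assignments $A$. An assignment $A$ is *$\beta$-all-norm* if $\|L_A\|_p\le\beta\cdot\mathrm{OPT}_p$ for all real $p\ge1$. In the *$\beta$-all-norm oracle problem* one is also given values $\lambda(c)\ge0$, and has to compute $z:E\to\mathbb R_{\ge0}$ with $\sum_c\lambda(c)z(\delta(c))\ge\sum_c\lambda(c)$ and $\|L_z\|_p\le\beta\cdot\mathrm{OPT}_p$ for all $p\ge1$. An algorithm for it is *$d$-bounded* if its outputs always satisfy $|z(\delta(c))-1|\le d$ for all $c\in C$. A *streaming algorithm*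 is deterministic. It knows $C$, $S$, $w$ (and $\lambda$, for the oracle problem) in advance, as read-only input, and in each pass reads the edges one at a time, in an arbitrary order that is the same in all passes. It keeps only a string of bits, which it may rewrite arbitrarily whenever an edge arrives or a pass ends; before each pass it decides from this string whether to stop, and when it stops the output is determined by this string. Its space is the largest length of the string during the run. **Lemma.** There is an absolute constant $K>0$ such that the following holds. Let $\beta=\beta(n)$ and $d=d(n)$ be real-valued with $d\beta\ge1$ for all $n$, and let $p=p(n,m)$ and $S(n,m)$ take values in the non-negative integers. Suppose that there is a $d$-bounded streaming algorithm for the $\beta$-all-norm oracle problem that, on all instances with parameters $n,m$, uses at most $p$ passes and $S(n,m)$ space. Then there is a streaming algorithm that on every instance with parameters $n,m$ computes a $(\beta+2)$-all-norm assignment using at most $$K\,p\,d^2\beta^2\log n\ \text{ passes and at most }\ K\bigl(S(n,m)\,\beta^2d^2\log n+n\bigr)\ \text{ space}.$$ -/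

import Mathlib

open scoped NNReal

/-! ### Multi-pass streaming algorithms -/

/-- A deterministic multi-pass streaming algorithm that reads a stream of items of type `α` and
produces a value of type `Out`.  The only thing kept between two events of the computation (arrival
of an item, end of a pass) is a string of bits, the *memory*.  The algorithm reacts to the arrival
of an item and to the end of a pass by rewriting its memory; before every pass it decides from its
memory whether to stop, and on stopping the output is determined by the memory. -/
structure StreamingAlgorithm (α Out : Type) where
  init : List Bool
  read : List Bool → α → List Bool
  endPass : List Bool → List Bool
  halted : List Bool → Bool
  output : List Bool → Out

namespace StreamingAlgorithm

variable {α Out : Type}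

/-- The memory after `i` items of the stream `σ` have been read in a pass that started with
memory `x`. -/
def memInPass (M : StreamingAlgorithm α Out) (σ : List α) (x : List Bool) (i : ℕ) : List Bool :=
  (σ.take i).foldl M.read x

/-- The memory after `k` complete passes over the stream `σ`. -/
def memAfter (M : StreamingAlgorithm α Out) (σ : List α) : ℕ → List Bool
  | 0 => M.init
  | k + 1 => M.endPass (M.memInPass σ (M.memAfter σ k) σ.length)

/-- On the stream `σ` the algorithm stops after at most `passes` passes, at no time holds more than
`space` bits of memory, and outputs `o`. -/
def ComputesWithin (M : StreamingAlgorithm α Out) (σ : List α) (passes space : ℝ) (o : Out) :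
    Prop :=
  ∃ k : ℕ, (k : ℝ) ≤ passes ∧
    (∀ j < k, M.halted (M.memAfter σ j) = false) ∧
    M.halted (M.memAfter σ k) = true ∧
    (∀ j < k, ∀ i ≤ σ.length, ((M.memInPass σ (M.memAfter σ j) i).length : ℝ) ≤ space) ∧
    ((M.memAfter σ k).length : ℝ) ≤ space ∧
    M.output (M.memAfter σ k) = o

end StreamingAlgorithm

/-! ### Load balancing

Clients are the elements of `Fin a`, servers those of `Fin b`, and a bipartite graph is given by its
finite set `E` of edges. -/

section LoadBalancing

variable {a b : ℕ}

/-- Every client has at least one server it may be assigned to. -/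
def Feasible (E : Finset (Fin a × Fin b)) : Prop :=
  ∀ c, ∃ s, (c, s) ∈ E

/-- `σ` lists every edge of `E` exactly once, in an arbitrary order. -/
def IsStreamOf (σ : List (Fin a × Fin b)) (E : Finset (Fin a × Fin b)) : Prop :=
  σ.Nodup ∧ ∀ e, e ∈ σ ↔ e ∈ E

/-- The `ℓ_p` norm (for a real exponent `p ≥ 1`) of a vector indexed by the servers. -/
noncomputable def lpNorm (p : ℝ) (L : Fin b → ℝ) : ℝ :=
  (∑ s, |L s| ^ p) ^ (1 / p)

/-- An (integral) assignment: a set of edges containing exactly one edge at every client. -/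
def IsAssignment (E A : Finset (Fin a × Fin b)) : Prop :=
  A ⊆ E ∧ ∀ c, ∃! s, (c, s) ∈ A

/-- The load vector of a set of edges: the total weight of the clients assigned to each server. -/
noncomputable def load (w : Fin a → ℕ+) (A : Finset (Fin a × Fin b)) (s : Fin b) : ℝ :=
  ∑ c with (c, s) ∈ A, ((w c : ℕ) : ℝ)

/-- The load vector of a fractional edge vector. -/
noncomputable def fracLoad (w : Fin a → ℕ+) (z : Fin a → Fin b → ℝ≥0) (s : Fin b) : ℝ :=
  ∑ c, ((w c : ℕ) : ℝ) * (z c s : ℝ)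

/-- `OPT_p`: the smallest `ℓ_p` norm of the load vector of an integral assignment. -/
noncomputable def optNorm (E : Finset (Fin a × Fin b)) (w : Fin a → ℕ+) (p : ℝ) : ℝ :=
  sInf {x | ∃ A, IsAssignment E A ∧ x = lpNorm p (load w A)}

/-- `A` is a `β`-all-norm assignment. -/
def IsAllNormAssignment (E : Finset (Fin a × Fin b)) (w : Fin a → ℕ+) (β : ℝ)
    (A : Finset (Fin a × Fin b)) : Prop :=
  IsAssignment E A ∧ ∀ p : ℝ, 1 ≤ p → lpNorm p (load w A) ≤ β * optNorm E w p

/-- `z(δ(c))`: the total amount to which `z` assigns the client `c`. -/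
noncomputable def cover (z : Fin a → Fin b → ℝ≥0) (c : Fin a) : ℝ :=
  ∑ s, (z c s : ℝ)

/-- `z` solves the `β`-all-norm oracle problem for the graph `E`, the weights `w` and the values
`lam`: it lives on the edges, satisfies the combined client covering constraint, and satisfies the
`β`-approximate `ℓ_p`-norm constraint for every `p ≥ 1`. -/
def IsOracleSolution (E : Finset (Fin a × Fin b)) (w : Fin a → ℕ+) (lam : Fin a → ℝ≥0) (β : ℝ)
    (z : Fin a → Fin b → ℝ≥0) : Prop :=
  (∀ c s, (c, s) ∉ E → z c s = 0) ∧
  ∑ c, (lam c : ℝ) ≤ ∑ c, (lam c : ℝ) * cover z c ∧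
  ∀ p : ℝ, 1 ≤ p → lpNorm p (fracLoad w z) ≤ β * optNorm E w p

/-- `z` stays within `d` of covering each client exactly once. -/
def IsWidthBounded (d : ℝ) (z : Fin a → Fin b → ℝ≥0) : Prop :=
  ∀ c, |cover z c - 1| ≤ d

end LoadBalancing

/-! ### Streaming algorithms for the two problems

The numbers of clients and servers, the weights, and (for the oracle problem) the values are
read-only input that is known in advance; the edges arrive in the stream.  The number of edges is
not known in advance. -/

/-- A streaming algorithm for the oracle problem. -/
abbrev OracleAlgorithm : Type :=
  ∀ (a b : ℕ) (_w : Fin a → ℕ+) (_lam : Fin a → ℝ≥0),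
    StreamingAlgorithm (Fin a × Fin b) (Fin a → Fin b → ℝ≥0)

/-- A streaming algorithm that outputs a set of edges. -/
abbrev AssignmentAlgorithm : Type :=
  ∀ (a b : ℕ) (_w : Fin a → ℕ+), StreamingAlgorithm (Fin a × Fin b) (Finset (Fin a × Fin b))

/-- On every instance with `n` vertices and `m` edges, and for every order of the stream, the
algorithm uses at most `passes n m` passes and at most `space n m` bits, and outputs a
`d n`-bounded solution of the `β n`-all-norm oracle problem. -/
def OracleAlgorithm.Solves (O : OracleAlgorithm) (β d : ℕ → ℝ) (passes space : ℕ → ℕ → ℝ) : Prop :=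
  ∀ (a b : ℕ) (w : Fin a → ℕ+) (lam : Fin a → ℝ≥0) (E : Finset (Fin a × Fin b))
    (σ : List (Fin a × Fin b)), Feasible E → IsStreamOf σ E →
    ∃ z, IsOracleSolution E w lam (β (a + b)) z ∧ IsWidthBounded (d (a + b)) z ∧
      (O a b w lam).ComputesWithin σ (passes (a + b) E.card) (space (a + b) E.card) z

/-- On every instance with `n` vertices and `m` edges, and for every order of the stream, the
algorithm uses at most `passes n m` passes and at most `space n m` bits, and outputs a
`β n`-all-norm assignment. -/
def AssignmentAlgorithm.Solves (M : AssignmentAlgorithm) (β : ℕ → ℝ)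
    (passes space : ℕ → ℕ → ℝ) : Prop :=
  ∀ (a b : ℕ) (w : Fin a → ℕ+) (E : Finset (Fin a × Fin b)) (σ : List (Fin a × Fin b)),
    Feasible E → IsStreamOf σ E →
    ∃ A, IsAllNormAssignment E w (β (a + b)) A ∧
      (M a b w).ComputesWithin σ (passes (a + b) E.card) (space (a + b) E.card) A

/-! ### Rounding a fractional assignment -/

/-! Multiplicative weights turn oracle answers, which cover the clients only in a weighted combined
sense, into a vector that almost covers every client. Take ε = 1/(β+1), η = ε/(2d²), and T =
⌈4d²(β+1)² log n⌉ rounds. In each round a client has weight exp(-η · (excess coverage so far)). The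
oracle constraint cancels the first-order growth of the total weight, so one round multiplies it by
at most exp(η²d²). Hence no client lags by more than εT, and the sum Z of the answers covers each
client at least Tβ/(β+1) times (`cover_ge_of_sum_mwuWeight_le`). By the triangle inequality ‖L_Z‖_p
≤ Tβ·OPT_p, so normalising Z to cover every client exactly once gives norm at most (β+1)·OPT_p, for
all p at once.

Rounding (`exists_isRounding`) adds to each server at most the weight of one client assigned there.
These clients are distinct, so the added load vector has norm at most OPT_p
(`lpNorm_injOn_le_optNorm`). This gives β+2.

Neither Z nor the weights are stored: they may be reals, and Z may have many entries. The memory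
holds only the final memory strings of the completed oracle runs and the current memory of the
running one. Since the oracle algorithm is deterministic, these strings determine all answers, hence
all weights and Z. This costs O(TS) bits and at most T·p passes (`mwuAlgorithm_computesWithin`). -/

/-- The part of the interval `[0, t]` that lies in the `j`-th unit interval. -/
noncomputable def slotFill (j : ℕ) (t : ℝ) : ℝ := min (max (t - j) 0) 1

theorem slotFill_mono (j : ℕ) : Monotone (slotFill j) := fun s t h => by
  unfold slotFill; gcongr

theorem slotFill_nonneg (j : ℕ) (t : ℝ) : 0 ≤ slotFill j t :=
  le_min (le_max_right _ _) zero_le_one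

theorem slotFill_le_one (j : ℕ) (t : ℝ) : slotFill j t ≤ 1 := min_le_right _ _

theorem slotFill_of_le {j : ℕ} {t : ℝ} (h : t ≤ j) : slotFill j t = 0 := by
  unfold slotFill
  rw [max_eq_right (by linarith)]
  norm_num

theorem slotFill_of_ge {j : ℕ} {t : ℝ} (h : (j : ℝ) + 1 ≤ t) : slotFill j t = 1 :=
  min_eq_right (le_max_of_le_left (by linarith))

theorem sum_slotFill_eq_min (N : ℕ) {t : ℝ} (ht : 0 ≤ t) :
    ∑ j ∈ Finset.range N, slotFill j t = min t N := by
  induction N with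
  | zero => simp [ht]
  | succ N ih =>
    rw [Finset.sum_range_succ, ih]
    push_cast
    rcases le_total t N with h | h
    · rw [slotFill_of_le h, min_eq_left h, min_eq_left (by linarith), add_zero]
    · rw [min_eq_right h]
      unfold slotFill
      rw [max_eq_left (by linarith), ← min_add_add_left]
      congr 1
      ring

/-- The amount of item `i` put into the `j`-th unit slot, if items of sizes `u 0, u 1, …` are
poured consecutively into the slots. -/
noncomputable def slotShare (u : ℕ → ℝ) (i j : ℕ) : ℝ :=
  slotFill j (∑ k ∈ Finset.range (i + 1), u k) - slotFill j (∑ k ∈ Finset.range i, u k)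

section SlotShare

variable {u : ℕ → ℝ}

theorem slotShare_nonneg (hu : ∀ i, 0 ≤ u i) (i j : ℕ) : 0 ≤ slotShare u i j := by
  refine sub_nonneg.2 (slotFill_mono j ?_)
  rw [Finset.sum_range_succ]
  linarith [hu i]

theorem sum_slotShare_items (u : ℕ → ℝ) (n j : ℕ) :
    ∑ i ∈ Finset.range n, slotShare u i j = slotFill j (∑ k ∈ Finset.range n, u k) := by
  unfold slotShare
  rw [Finset.sum_range_sub (fun i => slotFill j (∑ k ∈ Finset.range i, u k))]
  simp [slotFill_of_le]

theorem sum_slotShare_slots (hu : ∀ i, 0 ≤ u i) {i N : ℕ}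
    (h : ∑ k ∈ Finset.range (i + 1), u k ≤ N) :
    ∑ j ∈ Finset.range N, slotShare u i j = u i := by
  have h0 : ∀ m, 0 ≤ ∑ k ∈ Finset.range m, u k := fun m => Finset.sum_nonneg fun k _ => hu k
  have h1 : ∑ k ∈ Finset.range (i + 1), u k = ∑ k ∈ Finset.range i, u k + u i :=
    Finset.sum_range_succ _ _
  unfold slotShare
  rw [Finset.sum_sub_distrib, sum_slotFill_eq_min N (h0 _), sum_slotFill_eq_min N (h0 _),
    min_eq_left h, min_eq_left (by linarith [hu i])]
  linarith

theorem pos_of_slotShare_pos (hu : ∀ i, 0 ≤ u i) {i j : ℕ} (h : 0 < slotShare u i j) :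
    0 < u i := by
  refine (hu i).lt_of_ne fun h0 => ?_
  simp [slotShare, Finset.sum_range_succ, ← h0] at h

/-- If the items come in the order of decreasing weight, then the weight of an item in slot `j + 1`
is at most the average weight in slot `j`. -/
theorem weight_le_of_slotShare_pos (hu : ∀ i, 0 ≤ u i) {n i j : ℕ} {v : ℕ → ℝ}
    (hv0 : ∀ k < n, 0 ≤ v k) (hv : ∀ k ≤ i, v i ≤ v k) (hi : i < n)
    (h : 0 < slotShare u i (j + 1)) :
    v i ≤ ∑ k ∈ Finset.range n, v k * slotShare u k j := by
  -- A positive share in slot `j + 1` means that items `0, …, i` already fill slot `j`. Their shares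
  -- there sum to 1, and `v i` is at most the corresponding average of their weights.
  have hfull : (j : ℝ) + 1 ≤ ∑ k ∈ Finset.range (i + 1), u k := by
    by_contra! hlt
    have h1 : slotFill (j + 1) (∑ k ∈ Finset.range (i + 1), u k) = 0 :=
      slotFill_of_le (by push_cast; exact hlt.le)
    have := slotFill_nonneg (j + 1) (∑ k ∈ Finset.range i, u k)
    unfold slotShare at h
    linarith
  calc v i = ∑ k ∈ Finset.range (i + 1), v i * slotShare u k j := by
        rw [← Finset.mul_sum, sum_slotShare_items, slotFill_of_ge hfull, mul_one]
    _ ≤ ∑ k ∈ Finset.range (i + 1), v k * slotShare u k j := by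
        refine Finset.sum_le_sum fun k hk => ?_
        exact mul_le_mul_of_nonneg_right (hv k (by simpa [Nat.lt_succ_iff] using hk))
          (slotShare_nonneg hu k j)
    _ ≤ _ := by
        refine Finset.sum_le_sum_of_subset_of_nonneg (Finset.range_mono hi) fun k hk _ => ?_
        exact mul_nonneg (hv0 k (Finset.mem_range.1 hk)) (slotShare_nonneg hu k j)

end SlotShare

/-- The function `f` rounds the fractional assignment `x`: it uses only edges in the support of `x`,
and exceeds the load of `x` at every server by at most the weight of one client assigned there. -/
def IsRounding {a b : ℕ} (w : Fin a → ℝ) (x : Fin a → Fin b → ℝ) (f : Fin a → Fin b) : Prop :=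
  (∀ c, 0 < x c (f c)) ∧ ∃ R : Finset (Fin a), Set.InjOn f R ∧
    ∀ s, ∑ c with f c = s, w c ≤ ∑ c, w c * x c s + ∑ c ∈ R with f c = s, w c

/-- At each server, pour the fractions of the clients, heaviest first, into unit slots. The shares
match the clients fractionally to slots, so Hall's theorem gives an integral matching. A client in a
slot after the first weighs at most the average weight in the preceding slot, so all these clients
together are paid for by the fractional load. Only the client in slot 0 remains, at most one per
server. -/
theorem exists_isRounding_of_antitone {a b : ℕ} {w : Fin a → ℝ} (hw : Antitone w)
    (hw0 : ∀ c, 0 ≤ w c) {x : Fin a → Fin b → ℝ} (hx0 : ∀ c s, 0 ≤ x c s)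
    (hx1 : ∀ c, ∑ s, x c s = 1) : ∃ f, IsRounding w x f := by
  classical
  let u : Fin b → ℕ → ℝ := fun s i => if h : i < a then x ⟨i, h⟩ s else 0
  let v : ℕ → ℝ := fun i => if h : i < a then w ⟨i, h⟩ else 0
  have hux : ∀ s (c : Fin a), u s c = x c s := fun s c => by simp [u]
  have hvw : ∀ c : Fin a, v c = w c := fun c => by simp [v]
  have hu0 : ∀ s i, 0 ≤ u s i := fun s i => by
    simp only [u]; split_ifs
    exacts [hx0 _ _, le_rfl]
  have hx_le : ∀ c s, x c s ≤ 1 := fun c s => by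
    rw [← hx1 c]
    exact Finset.single_le_sum (fun s _ => hx0 c s) (Finset.mem_univ s)
  have hu_le : ∀ s i, u s i ≤ 1 := fun s i => by
    simp only [u]; split_ifs
    exacts [hx_le _ _, zero_le_one]
  have hpre : ∀ s (c : Fin a), ∑ k ∈ Finset.range (c + 1), u s k ≤ (a : ℝ) := fun s c => by
    calc ∑ k ∈ Finset.range (c + 1), u s k ≤ ∑ k ∈ Finset.range (c + 1), (1 : ℝ) :=
          Finset.sum_le_sum fun k _ => hu_le s k
      _ = ((c + 1 : ℕ) : ℝ) := by simp
      _ ≤ a := by exact_mod_cast c.2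
  let Y : Fin a → Fin b × ℕ → ℝ := fun c q => slotShare (u q.1) c q.2
  have hY0 : ∀ c q, 0 ≤ Y c q := fun c q => slotShare_nonneg (hu0 _) _ _
  -- Each of the `a` clients contributes at most 1 to a server, so `a` slots per server hold
  -- everything.
  let slots : Finset (Fin b × ℕ) := Finset.univ ×ˢ Finset.range a
  let t : Fin a → Finset (Fin b × ℕ) := fun c => slots.filter fun q => 0 < Y c q
  have hYsum : ∀ c s, ∑ j ∈ Finset.range a, Y c (s, j) = x c s := fun c s => by
    rw [← hux s c]
    exact sum_slotShare_slots (hu0 s) (hpre s c)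
  have hYcol : ∀ q, ∑ c, Y c q ≤ 1 := fun q => by
    have : ∑ c, Y c q = ∑ i ∈ Finset.range a, slotShare (u q.1) i q.2 :=
      Fin.sum_univ_eq_sum_range (fun i => slotShare (u q.1) i q.2) a
    rw [this, sum_slotShare_items]
    exact slotFill_le_one _ _
  have hrow : ∀ c, ∑ q ∈ t c, Y c q = 1 := fun c => by
    rw [Finset.sum_filter_of_ne fun q _ hq => (hY0 c q).lt_of_ne' hq, Finset.sum_product,
      ← hx1 c]
    exact Finset.sum_congr rfl fun s _ => hYsum c s
  -- Hall's condition by double counting: each client sends total share 1, each slot receives at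
  -- most 1.
  have hall : ∀ X : Finset (Fin a), X.card ≤ (X.biUnion t).card := fun X => by
    have : (X.card : ℝ) ≤ (X.biUnion t).card := by
      calc (X.card : ℝ) = ∑ c ∈ X, ∑ q ∈ t c, Y c q := by simp [hrow]
        _ ≤ ∑ c ∈ X, ∑ q ∈ X.biUnion t, Y c q := Finset.sum_le_sum fun c hc =>
            Finset.sum_le_sum_of_subset_of_nonneg (Finset.subset_biUnion_of_mem t hc)
              fun q _ _ => hY0 c q
        _ = ∑ q ∈ X.biUnion t, ∑ c ∈ X, Y c q := Finset.sum_comm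
        _ ≤ ∑ q ∈ X.biUnion t, (1 : ℝ) := Finset.sum_le_sum fun q _ =>
            (Finset.sum_le_sum_of_subset_of_nonneg (Finset.subset_univ X)
              fun c _ _ => hY0 c q).trans (hYcol q)
        _ = _ := by simp
    exact_mod_cast this
  obtain ⟨m, hm_inj, hm⟩ := (Finset.all_card_le_biUnion_card_iff_exists_injective t).1 hall
  have hmem : ∀ c, (m c).2 < a ∧ 0 < Y c (m c) := fun c => by
    have := hm c
    simp only [t, slots, Finset.mem_filter, Finset.mem_product, Finset.mem_range] at this
    exact ⟨this.1.2, this.2⟩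
  refine ⟨fun c => (m c).1, fun c => ?_, Finset.univ.filter fun c => (m c).2 = 0, ?_, fun s => ?_⟩
  · rw [← hux]
    exact pos_of_slotShare_pos (hu0 _) (hmem c).2
  · intro c hc c' hc' h
    simp only [Finset.coe_filter, Finset.mem_univ, true_and, Set.mem_ofPred_eq] at hc hc'
    exact hm_inj (Prod.ext h (hc.trans hc'.symm))
  · let G : ℕ → ℝ := fun j => ∑ c, w c * Y c (s, j)
    have hG0 : ∀ j, 0 ≤ G j := fun j =>
      Finset.sum_nonneg fun c _ => mul_nonneg (hw0 c) (hY0 c _)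
    have hGsum : ∑ j ∈ Finset.range a, G j = ∑ c, w c * x c s := by
      simp only [G]
      rw [Finset.sum_comm]
      exact Finset.sum_congr rfl fun c _ => by rw [← Finset.mul_sum, hYsum]
    have hle : ∀ c, (m c).1 = s → (m c).2 ≠ 0 → w c ≤ G ((m c).2 - 1) := fun c hs h0 => by
      obtain ⟨j, hj⟩ := Nat.exists_eq_succ_of_ne_zero h0
      have hpos : 0 < slotShare (u s) c (j + 1) := by
        have := (hmem c).2
        simp only [Y, hs, hj] at this
        exact this
      have key := weight_le_of_slotShare_pos (hu0 s) (n := a) (v := v)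
        (fun k hk => by simp only [v, dif_pos hk]; exact hw0 _)
        (fun k hk => by
          have hka : k < a := hk.trans_lt c.2
          rw [hvw]
          simp only [v, dif_pos hka]
          exact hw (Fin.le_def.2 hk)) c.2 hpos
      rw [hvw, ← Fin.sum_univ_eq_sum_range (fun k => v k * slotShare (u s) k j) a] at key
      simpa only [hvw, hj, Nat.succ_eq_add_one, Nat.add_sub_cancel] using key
    set P := Finset.univ.filter fun c => (m c).1 = s with hP
    have hsplit := Finset.sum_filter_add_sum_filter_not P (fun c => (m c).2 = 0) w
    have hzero : ∑ c ∈ P with (m c).2 = 0, w c =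
        ∑ c ∈ Finset.univ.filter (fun c => (m c).2 = 0) with (m c).1 = s, w c := by
      rw [hP, Finset.filter_comm]
    -- The matching uses each slot once, so distinct clients at `s` are charged to distinct
    -- preceding slots.
    have hinj : Set.InjOn (fun c => (m c).2 - 1) (P.filter fun c => ¬ (m c).2 = 0) := by
      intro c hc c' hc' h
      simp only [hP, Finset.coe_filter, Finset.mem_filter, Finset.mem_univ, true_and,
        Set.mem_ofPred_eq] at hc hc' h
      exact hm_inj (Prod.ext (hc.1.trans hc'.1.symm) (by omega))
    have hrest : ∑ c ∈ P with ¬ (m c).2 = 0, w c ≤ ∑ c, w c * x c s := by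
      calc ∑ c ∈ P with ¬ (m c).2 = 0, w c
          ≤ ∑ c ∈ P with ¬ (m c).2 = 0, G ((m c).2 - 1) := Finset.sum_le_sum fun c hc => by
            simp only [hP, Finset.mem_filter, Finset.mem_univ, true_and] at hc
            exact hle c hc.1 hc.2
        _ = ∑ j ∈ (P.filter fun c => ¬ (m c).2 = 0).image (fun c => (m c).2 - 1), G j :=
            (Finset.sum_image hinj).symm
        _ ≤ ∑ j ∈ Finset.range a, G j := by
            refine Finset.sum_le_sum_of_subset_of_nonneg ?_ fun j _ _ => hG0 j
            intro j hj
            obtain ⟨c, -, rfl⟩ := Finset.mem_image.1 hj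
            exact Finset.mem_range.2 ((Nat.sub_le _ _).trans_lt (hmem c).1)
        _ = _ := hGsum
    linarith

/-- Sorting the clients by decreasing weight reduces to the antitone case; the notion of rounding is
invariant under relabelling clients. -/
theorem exists_isRounding {a b : ℕ} {w : Fin a → ℝ} (hw0 : ∀ c, 0 ≤ w c)
    {x : Fin a → Fin b → ℝ} (hx0 : ∀ c s, 0 ≤ x c s) (hx1 : ∀ c, ∑ s, x c s = 1) :
    ∃ f, IsRounding w x f := by
  classical
  let π : Equiv.Perm (Fin a) := Tuple.sort fun c => -w c
  have hπ : Antitone (w ∘ π) := fun i j h =>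
    neg_le_neg_iff.1 (Tuple.monotone_sort (fun c => -w c) h)
  obtain ⟨f, hf, R, hR, hload⟩ := exists_isRounding_of_antitone (x := fun c => x (π c)) hπ
    (fun c => hw0 _) (fun c s => hx0 _ s) (fun c => hx1 _)
  refine ⟨fun c => f (π.symm c), fun c => by simpa using hf (π.symm c), R.image π, ?_, fun s => ?_⟩
  · intro c hc c' hc' h
    obtain ⟨i, hi, rfl⟩ := Finset.mem_image.1 (Finset.mem_coe.1 hc)
    obtain ⟨i', hi', rfl⟩ := Finset.mem_image.1 (Finset.mem_coe.1 hc')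
    rw [hR hi hi' (by simpa using h)]
  · have h1 : ∑ c with f (π.symm c) = s, w c = ∑ c with f c = s, (w ∘ π) c := by
      simp only [Finset.sum_filter]
      rw [← Equiv.sum_comp π]
      simp
    have h2 : ∑ c, w c * x c s = ∑ c, (w ∘ π) c * x (π c) s :=
      (Equiv.sum_comp π fun c => w c * x c s).symm
    have h3 : ∑ c ∈ R.image π with f (π.symm c) = s, w c = ∑ c ∈ R with f c = s, (w ∘ π) c := by
      simp only [Finset.sum_filter]
      rw [Finset.sum_image π.injective.injOn]
      simp
    rw [h1, h2, h3]
    exact hload s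

/-! ### Norms of load vectors -/

section Norms

variable {a b : ℕ} {p : ℝ}

theorem lpNorm_nonneg (p : ℝ) (L : Fin b → ℝ) : 0 ≤ lpNorm p L :=
  Real.rpow_nonneg (Finset.sum_nonneg fun _ _ => Real.rpow_nonneg (abs_nonneg _) _) _

theorem lpNorm_zero (hp : 1 ≤ p) : lpNorm p (fun _ : Fin b => 0) = 0 := by
  have : p ≠ 0 := by linarith
  simp [lpNorm, Real.zero_rpow, this]

theorem lpNorm_add_le (hp : 1 ≤ p) (L L' : Fin b → ℝ) :
    lpNorm p (fun s => L s + L' s) ≤ lpNorm p L + lpNorm p L' :=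
  Real.Lp_add_le _ _ _ hp

theorem lpNorm_mul (hp : 1 ≤ p) {r : ℝ} (hr : 0 ≤ r) (L : Fin b → ℝ) :
    lpNorm p (fun s => r * L s) = r * lpNorm p L := by
  have hp0 : p ≠ 0 := by linarith
  unfold lpNorm
  simp only [abs_mul, abs_of_nonneg hr, Real.mul_rpow hr (abs_nonneg _), ← Finset.mul_sum]
  rw [Real.mul_rpow (Real.rpow_nonneg hr _)
    (Finset.sum_nonneg fun _ _ => Real.rpow_nonneg (abs_nonneg _) _), ← Real.rpow_mul hr,
    mul_one_div_cancel hp0, Real.rpow_one]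

theorem lpNorm_le_of_sum_le (hp : 1 ≤ p) {L L' : Fin b → ℝ}
    (h : ∑ s, |L s| ^ p ≤ ∑ s, |L' s| ^ p) : lpNorm p L ≤ lpNorm p L' :=
  Real.rpow_le_rpow (Finset.sum_nonneg fun _ _ => Real.rpow_nonneg (abs_nonneg _) _) h
    (by positivity)

theorem lpNorm_mono (hp : 1 ≤ p) {L L' : Fin b → ℝ} (h0 : ∀ s, 0 ≤ L s) (h : ∀ s, L s ≤ L' s) :
    lpNorm p L ≤ lpNorm p L' :=
  lpNorm_le_of_sum_le hp <| Finset.sum_le_sum fun s _ => by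
    rw [abs_of_nonneg (h0 s), abs_of_nonneg ((h0 s).trans (h s))]
    exact Real.rpow_le_rpow (h0 s) (h s) (by linarith)

theorem sum_rpow_le_rpow_sum {ι : Type*} (F : Finset ι) {v : ι → ℝ} (hv : ∀ i, 0 ≤ v i)
    (hp : 1 ≤ p) : ∑ i ∈ F, v i ^ p ≤ (∑ i ∈ F, v i) ^ p := by
  classical
  induction F using Finset.induction_on with
  | empty => simp [Real.zero_rpow (show p ≠ 0 by linarith)]
  | insert i F hi ih =>
    rw [Finset.sum_insert hi, Finset.sum_insert hi]
    exact (add_le_add_right ih _).trans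
      (Real.add_rpow_le_rpow_add (hv i) (Finset.sum_nonneg fun j _ => hv j) hp)

/-- The assignment given by a function from clients to servers. -/
def graphAssignment (f : Fin a → Fin b) : Finset (Fin a × Fin b) :=
  Finset.univ.image fun c => (c, f c)

theorem mem_graphAssignment {f : Fin a → Fin b} {c : Fin a} {s : Fin b} :
    (c, s) ∈ graphAssignment f ↔ f c = s := by
  simp [graphAssignment]

theorem isAssignment_graphAssignment {E : Finset (Fin a × Fin b)} {f : Fin a → Fin b}
    (hf : ∀ c, (c, f c) ∈ E) : IsAssignment E (graphAssignment f) := by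
  refine ⟨fun e he => ?_, fun c => ⟨f c, mem_graphAssignment.2 rfl, fun s hs => ?_⟩⟩
  · obtain ⟨c, -, rfl⟩ := Finset.mem_image.1 he
    exact hf c
  · exact (mem_graphAssignment.1 hs).symm

theorem load_graphAssignment (w : Fin a → ℕ+) (f : Fin a → Fin b) (s : Fin b) :
    load w (graphAssignment f) s = ∑ c with f c = s, ((w c : ℕ) : ℝ) := by
  simp only [load, mem_graphAssignment]

theorem IsAssignment.exists_eq_graphAssignment {E A : Finset (Fin a × Fin b)}
    (hA : IsAssignment E A) : ∃ f, A = graphAssignment f := by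
  choose f hf using hA.2
  refine ⟨f, Finset.ext fun ⟨c, s⟩ => ?_⟩
  rw [mem_graphAssignment]
  exact ⟨fun h => ((hf c).2 s h).symm, fun h => h ▸ (hf c).1⟩

theorem Feasible.exists_isAssignment {E : Finset (Fin a × Fin b)} (hE : Feasible E) :
    ∃ A, IsAssignment E A := by
  choose f hf using hE
  exact ⟨_, isAssignment_graphAssignment hf⟩

theorem optNorm_nonneg (E : Finset (Fin a × Fin b)) (w : Fin a → ℕ+) (p : ℝ) :
    0 ≤ optNorm E w p :=
  Real.sInf_nonneg (by rintro _ ⟨A, -, rfl⟩; exact lpNorm_nonneg _ _)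

theorem optNorm_le {E A : Finset (Fin a × Fin b)} (hA : IsAssignment E A) (w : Fin a → ℕ+)
    (p : ℝ) : optNorm E w p ≤ lpNorm p (load w A) :=
  csInf_le ⟨0, by rintro _ ⟨A, -, rfl⟩; exact lpNorm_nonneg _ _⟩ ⟨A, hA, rfl⟩

/-- A vector of weights of distinct clients, one for each server, has norm at most `OPT_p`. -/
theorem lpNorm_injOn_le_optNorm {E : Finset (Fin a × Fin b)} (hE : Feasible E) (w : Fin a → ℕ+)
    (hp : 1 ≤ p) {f : Fin a → Fin b} {R : Finset (Fin a)} (hR : Set.InjOn f R) :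
    lpNorm p (fun s => ∑ c ∈ R with f c = s, ((w c : ℕ) : ℝ)) ≤ optNorm E w p := by
  have hp0 : p ≠ 0 := by linarith
  obtain ⟨A₀, hA₀⟩ := hE.exists_isAssignment
  refine le_csInf ⟨_, A₀, hA₀, rfl⟩ ?_
  rintro _ ⟨A, hA, rfl⟩
  obtain ⟨g, rfl⟩ := hA.exists_eq_graphAssignment
  refine lpNorm_le_of_sum_le hp ?_
  have h1 : ∀ s, |∑ c ∈ R with f c = s, ((w c : ℕ) : ℝ)| ^ p =
      ∑ c ∈ R with f c = s, ((w c : ℕ) : ℝ) ^ p := fun s => by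
    rw [abs_of_nonneg (by positivity)]
    rcases (R.filter fun c => f c = s).eq_empty_or_nonempty with h | ⟨c, hc⟩
    · simp [h, Real.zero_rpow hp0]
    · have : (R.filter fun c => f c = s) = {c} := by
        refine Finset.eq_singleton_iff_unique_mem.2 ⟨hc, fun c' hc' => ?_⟩
        rw [Finset.mem_filter] at hc hc'
        exact hR hc'.1 hc.1 (hc'.2.trans hc.2.symm)
      simp [this]
  have h2 : ∀ s, ∑ c with g c = s, ((w c : ℕ) : ℝ) ^ p ≤ |load w (graphAssignment g) s| ^ p :=
    fun s => by
      rw [load_graphAssignment, abs_of_nonneg (by positivity)]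
      exact sum_rpow_le_rpow_sum _ (fun c => by positivity) hp
  -- Both sides are compared with the sum of w(c)^p over all clients. It dominates the sum over `R`,
  -- and by superadditivity of t ↦ t^p it is at most the p-th power sum of the loads of any
  -- assignment.
  calc ∑ s, |∑ c ∈ R with f c = s, ((w c : ℕ) : ℝ)| ^ p
      = ∑ c ∈ R, ((w c : ℕ) : ℝ) ^ p := by
        simp only [h1]
        exact Finset.sum_fiberwise R f _
    _ ≤ ∑ c, ((w c : ℕ) : ℝ) ^ p :=
        Finset.sum_le_sum_of_subset_of_nonneg (Finset.subset_univ _) fun _ _ _ => by positivity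
    _ = ∑ s, ∑ c with g c = s, ((w c : ℕ) : ℝ) ^ p := (Finset.sum_fiberwise _ g _).symm
    _ ≤ _ := Finset.sum_le_sum fun s _ => h2 s

theorem fracLoad_nonneg (w : Fin a → ℕ+) (z : Fin a → Fin b → ℝ≥0) (s : Fin b) :
    0 ≤ fracLoad w z s :=
  Finset.sum_nonneg fun _ _ => by positivity

theorem fracLoad_add (w : Fin a → ℕ+) (z z' : Fin a → Fin b → ℝ≥0) (s : Fin b) :
    fracLoad w (z + z') s = fracLoad w z s + fracLoad w z' s := by
  simp [fracLoad, mul_add, Finset.sum_add_distrib]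

theorem cover_add (z z' : Fin a → Fin b → ℝ≥0) (c : Fin a) :
    cover (z + z') c = cover z c + cover z' c := by
  simp [cover, Finset.sum_add_distrib]

/-- The oracle problem with `λ = w` has a solution only if `1 ≤ β`. -/
theorem one_le_of_isOracleSolution [NeZero a] {E : Finset (Fin a × Fin b)} (hE : Feasible E)
    {w : Fin a → ℕ+} {β : ℝ} {z : Fin a → Fin b → ℝ≥0}
    (hz : IsOracleSolution E w (fun c => ((w c : ℕ) : ℝ≥0)) β z) : 1 ≤ β := by
  obtain ⟨A, hA⟩ := hE.exists_isAssignment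
  have hopt := optNorm_le hA w 1
  obtain ⟨g, rfl⟩ := hA.exists_eq_graphAssignment
  have h1 : lpNorm 1 (load w (graphAssignment g)) = ∑ c, ((w c : ℕ) : ℝ) := by
    simp only [lpNorm, Real.rpow_one, div_one, load_graphAssignment]
    rw [← Finset.sum_fiberwise Finset.univ g]
    exact Finset.sum_congr rfl fun s _ => abs_of_nonneg (by positivity)
  have h2 : lpNorm 1 (fracLoad w z) = ∑ c, ((w c : ℕ) : ℝ) * cover z c := by
    simp only [lpNorm, Real.rpow_one, div_one, abs_of_nonneg (fracLoad_nonneg w z _), cover,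
      Finset.mul_sum]
    exact Finset.sum_comm
  have h3 := hz.2.2 1 le_rfl
  have h4 := hz.2.1
  simp only [NNReal.coe_natCast] at h4
  have hpos : 0 < ∑ c, ((w c : ℕ) : ℝ) :=
    Finset.sum_pos (fun c _ => by exact_mod_cast (w c).pos) ⟨0, Finset.mem_univ _⟩
  have hopt0 := optNorm_nonneg E w 1
  rw [h1] at hopt
  rw [h2] at h3
  by_contra! hβ
  have hoptpos : 0 < optNorm E w 1 := by nlinarith
  nlinarith

/-- Rounding a fractional vector that almost covers every client. -/
theorem isAllNormAssignment_of_isRounding {E : Finset (Fin a × Fin b)} (hE : Feasible E)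
    {w : Fin a → ℕ+} {β t : ℝ} (hβ : 0 < β) (ht : 0 < t) {Z : Fin a → Fin b → ℝ≥0}
    (hsupp : ∀ c s, (c, s) ∉ E → Z c s = 0)
    (hnorm : ∀ p : ℝ, 1 ≤ p → lpNorm p (fracLoad w Z) ≤ t * (β * optNorm E w p))
    (hcover : ∀ c, t * (β / (β + 1)) ≤ cover Z c) {f : Fin a → Fin b}
    (hf : IsRounding (fun c => ((w c : ℕ) : ℝ)) (fun c s => (Z c s : ℝ) / cover Z c) f) :
    IsAllNormAssignment E w (β + 2) (graphAssignment f) := by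
  obtain ⟨hpos, R, hR, hload⟩ := hf
  have hfE : ∀ c, (c, f c) ∈ E := fun c => by
    by_contra h
    have := hpos c
    simp [hsupp c _ h] at this
  refine ⟨isAssignment_graphAssignment hfE, fun p hp => ?_⟩
  have hq : 0 < t * (β / (β + 1)) := by positivity
  set r : ℝ := (t * (β / (β + 1)))⁻¹ with hr
  have hr0 : 0 ≤ r := by positivity
  have hscale : ∀ s, ∑ c, ((w c : ℕ) : ℝ) * ((Z c s : ℝ) / cover Z c) ≤ r * fracLoad w Z s :=
    fun s => by
      rw [fracLoad, Finset.mul_sum]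
      refine Finset.sum_le_sum fun c _ => ?_
      have : (Z c s : ℝ) / cover Z c ≤ Z c s / (t * (β / (β + 1))) :=
        div_le_div_of_nonneg_left (Z c s).2 hq (hcover c)
      calc ((w c : ℕ) : ℝ) * ((Z c s : ℝ) / cover Z c)
          ≤ ((w c : ℕ) : ℝ) * (Z c s / (t * (β / (β + 1)))) := by gcongr
        _ = _ := by rw [hr]; ring
  calc lpNorm p (load w (graphAssignment f))
      ≤ lpNorm p (fun s => r * fracLoad w Z s + ∑ c ∈ R with f c = s, ((w c : ℕ) : ℝ)) := by
        refine lpNorm_mono hp (fun s => ?_) fun s => ?_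
        · rw [load_graphAssignment]; positivity
        · rw [load_graphAssignment]
          exact (hload s).trans (by gcongr; exact hscale s)
    _ ≤ r * lpNorm p (fracLoad w Z) + optNorm E w p := by
        refine (lpNorm_add_le hp _ _).trans ?_
        rw [lpNorm_mul hp hr0]
        gcongr
        exact lpNorm_injOn_le_optNorm hE w hp hR
    _ ≤ r * (t * (β * optNorm E w p)) + optNorm E w p := by
        gcongr
        exact hnorm p hp
    -- Here `r * t * β = β + 1`; the last unit is the cost of rounding.
    _ = (β + 2) * optNorm E w p := by
        rw [hr]
        field_simp
        ring

end Norms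

/-! ### Multiplicative weights -/

section MultiplicativeWeights

variable {a b : ℕ}

/-- The weights of the clients after `t` rounds, if `Z` is the sum of the vectors returned by the
oracle in these rounds. -/
noncomputable def mwuWeight (η : ℝ) (t : ℕ) (Z : Fin a → Fin b → ℝ≥0) (c : Fin a) : ℝ≥0 :=
  Real.toNNReal (Real.exp (-(η * (cover Z c - t))))

theorem coe_mwuWeight (η : ℝ) (t : ℕ) (Z : Fin a → Fin b → ℝ≥0) (c : Fin a) :
    (mwuWeight η t Z c : ℝ) = Real.exp (-(η * (cover Z c - t))) :=
  Real.coe_toNNReal _ (Real.exp_pos _).le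

/-- The factor of a client is exp(-ηv) ≤ 1 - ηv + η²d² with v its excess coverage in this round,
valid since |ηv| ≤ 1. The oracle constraint for the current weights makes the weighted sum of the
linear terms nonpositive. -/
theorem sum_mwuWeight_succ_le {η d : ℝ} (hη : 0 ≤ η) (hηd : η * d ≤ 1) {t : ℕ}
    {Z z : Fin a → Fin b → ℝ≥0} (hz : IsWidthBounded d z)
    (hcov : ∑ c, (mwuWeight η t Z c : ℝ) ≤ ∑ c, (mwuWeight η t Z c : ℝ) * cover z c) :
    ∑ c, (mwuWeight η (t + 1) (Z + z) c : ℝ) ≤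
      Real.exp (η ^ 2 * d ^ 2) * ∑ c, (mwuWeight η t Z c : ℝ) := by
  have hterm : ∀ c, (mwuWeight η (t + 1) (Z + z) c : ℝ) ≤
      mwuWeight η t Z c * (1 + η ^ 2 * d ^ 2) -
        η * (mwuWeight η t Z c * cover z c - mwuWeight η t Z c) := fun c => by
    set v := cover z c - 1 with hv
    have hvd : |v| ≤ d := hz c
    have hv2 : v ^ 2 ≤ d ^ 2 := sq_le_sq.2 (hvd.trans (le_abs_self d))
    have hηv : |-(η * v)| ≤ 1 := by
      rw [abs_neg, abs_mul, abs_of_nonneg hη]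
      exact (mul_le_mul_of_nonneg_left hvd hη).trans hηd
    have hexp : Real.exp (-(η * v)) ≤ 1 - η * v + η ^ 2 * d ^ 2 := by
      have := (abs_le.1 (Real.abs_exp_sub_one_sub_id_le hηv)).2
      nlinarith [mul_le_mul_of_nonneg_left hv2 (sq_nonneg η)]
    have hsplit : (mwuWeight η (t + 1) (Z + z) c : ℝ) =
        mwuWeight η t Z c * Real.exp (-(η * v)) := by
      rw [coe_mwuWeight, coe_mwuWeight, ← Real.exp_add, cover_add, hv]
      push_cast
      ring_nf
    rw [hsplit]
    have := mul_le_mul_of_nonneg_left hexp (mwuWeight η t Z c).2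
    rw [hv] at this ⊢
    refine this.trans (le_of_eq ?_)
    simp only [NNReal.val_eq_coe]
    ring
  calc ∑ c, (mwuWeight η (t + 1) (Z + z) c : ℝ)
      ≤ (∑ c, (mwuWeight η t Z c : ℝ)) * (1 + η ^ 2 * d ^ 2) -
        η * (∑ c, (mwuWeight η t Z c : ℝ) * cover z c - ∑ c, (mwuWeight η t Z c : ℝ)) := by
        rw [Finset.sum_mul, ← Finset.sum_sub_distrib, Finset.mul_sum, ← Finset.sum_sub_distrib]
        exact Finset.sum_le_sum fun c _ => hterm c
    _ ≤ (∑ c, (mwuWeight η t Z c : ℝ)) * (1 + η ^ 2 * d ^ 2) := by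
        nlinarith [mul_nonneg hη (sub_nonneg.2 hcov)]
    _ ≤ Real.exp (η ^ 2 * d ^ 2) * ∑ c, (mwuWeight η t Z c : ℝ) := by
        rw [mul_comm]
        refine mul_le_mul_of_nonneg_right ?_ (Finset.sum_nonneg fun c _ => (mwuWeight η t Z c).2)
        linarith [Real.add_one_le_exp (η ^ 2 * d ^ 2)]

/-- If the total weight is small after enough rounds, then every client is almost covered on
average. -/
theorem cover_ge_of_sum_mwuWeight_le {d ε : ℝ} (hd : 0 < d) (hε : 0 < ε) {t n : ℕ}
    (hn : a ≤ n) {Z : Fin a → Fin b → ℝ≥0}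
    (hZ : ∑ c, (mwuWeight (ε / (2 * d ^ 2)) t Z c : ℝ) ≤
      a * Real.exp (t * ((ε / (2 * d ^ 2)) ^ 2 * d ^ 2)))
    (ht : 4 * d ^ 2 * Real.log n ≤ t * ε ^ 2) (c : Fin a) : t * (1 - ε) ≤ cover Z c := by
  set η := ε / (2 * d ^ 2) with hη
  have hη0 : 0 < η := by positivity
  have ha : 0 < a := c.pos
  have h1 : Real.exp (-(η * (cover Z c - t))) ≤ a * Real.exp (t * (η ^ 2 * d ^ 2)) := by
    rw [← coe_mwuWeight]
    exact (Finset.single_le_sum (fun c _ => (mwuWeight η t Z c).2) (Finset.mem_univ c)).trans hZ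
  have h2 : -(η * (cover Z c - t)) ≤ Real.log n + t * (η ^ 2 * d ^ 2) := by
    rw [← Real.exp_le_exp, Real.exp_add, Real.exp_log (by exact_mod_cast ha.trans_le hn)]
    exact h1.trans (mul_le_mul_of_nonneg_right (by exact_mod_cast hn) (Real.exp_pos _).le)
  -- With this η the drift term tη²d² equals tηε/2, and the lower bound on t makes log n at most the
  -- same amount.
  have h3 : 2 * d ^ 2 * η = ε := by rw [hη]; field_simp
  have h4 : Real.log n ≤ t * η * ε / 2 := by
    have : 4 * d ^ 2 * Real.log n ≤ 4 * d ^ 2 * (t * η * ε / 2) :=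
      ht.trans (le_of_eq (by rw [← h3]; ring))
    exact le_of_mul_le_mul_left this (by positivity)
  have h5 : t * (η ^ 2 * d ^ 2) = t * η * ε / 2 := by rw [← h3]; ring
  rw [h5] at h2
  have h6 : η * (t - cover Z c) ≤ η * (t * ε) := by nlinarith
  have := le_of_mul_le_mul_left h6 hη0
  linarith

end MultiplicativeWeights

/-! ### Streaming algorithms with structured memory -/

namespace StreamingAlgorithm

variable {α Out Q : Type}

/-- The streaming algorithm that keeps the code of a state as its memory. -/
noncomputable def ofStates [Nonempty Q] (enc : Q → List Bool) (start : Q) (read : Q → α → Q)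
    (endPass : Q → Q) (halted : Q → Bool) (output : Q → Out) : StreamingAlgorithm α Out where
  init := enc start
  read x e := enc (read (Function.invFun enc x) e)
  endPass x := enc (endPass (Function.invFun enc x))
  halted x := halted (Function.invFun enc x)
  output x := output (Function.invFun enc x)

section OfStates

variable [Nonempty Q] {enc : Q → List Bool} {start : Q} {read : Q → α → Q} {endPass : Q → Q}
  {halted : Q → Bool} {output : Q → Out}

theorem memInPass_ofStates (henc : Function.Injective enc) (σ : List α) (q : Q) (i : ℕ) :
    (ofStates enc start read endPass halted output).memInPass σ (enc q) i =
      enc ((σ.take i).foldl read q) := by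
  unfold memInPass
  generalize σ.take i = l
  induction l generalizing q with
  | nil => rfl
  | cons e l ih =>
    rw [List.foldl_cons, List.foldl_cons, ← ih]
    simp [ofStates, Function.leftInverse_invFun henc q]

theorem memAfter_ofStates (henc : Function.Injective enc) (σ : List α) (k : ℕ) :
    (ofStates enc start read endPass halted output).memAfter σ k =
      enc ((fun q => endPass (σ.foldl read q))^[k] start) := by
  induction k with
  | zero => rfl
  | succ k ih =>
    rw [memAfter, ih, memInPass_ofStates henc, Function.iterate_succ_apply', List.take_length]
    simp [ofStates, Function.leftInverse_invFun henc _]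

/-- A run of an algorithm given by states, controlled by an invariant with a budget of passes. -/
theorem ofStates_computesWithin (henc : Function.Injective enc) {σ : List α} {space : ℝ}
    {Inv : ℕ → Q → Prop} {good : Out → Prop}
    (hstep : ∀ r q, Inv r q → halted q = false →
      (∃ r', r = r' + 1 ∧ Inv r' (endPass (σ.foldl read q))) ∧
        ∀ i, ((enc ((σ.take i).foldl read q)).length : ℝ) ≤ space)
    (hfinal : ∀ r q, Inv r q → halted q = true → ((enc q).length : ℝ) ≤ space ∧ good (output q))
    {r : ℕ} (hr : Inv r start) :
    ∃ o, good o ∧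
      (ofStates enc start read endPass halted output).ComputesWithin σ r space o := by
  have key : ∀ r q, Inv r q → ∃ k ≤ r,
      (∀ j < k, halted ((fun q => endPass (σ.foldl read q))^[j] q) = false ∧
        ∃ r', Inv r' ((fun q => endPass (σ.foldl read q))^[j] q)) ∧
      halted ((fun q => endPass (σ.foldl read q))^[k] q) = true ∧
        ∃ r', Inv r' ((fun q => endPass (σ.foldl read q))^[k] q) := by
    intro r
    induction r with
    | zero =>
      intro q hq
      refine ⟨0, le_rfl, by simp, ?_, 0, hq⟩
      by_contra h
      obtain ⟨⟨r', hr', -⟩, -⟩ := hstep 0 q hq (by simpa using h)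
      omega
    | succ r ih =>
      intro q hq
      cases hh : halted q with
      | true => exact ⟨0, Nat.zero_le _, by simp, hh, r + 1, hq⟩
      | false =>
        obtain ⟨⟨r', hr', hq'⟩, -⟩ := hstep _ q hq hh
        obtain rfl : r = r' := by omega
        obtain ⟨k, hk, h1, h2, h3⟩ := ih _ hq'
        refine ⟨k + 1, by omega, fun j hj => ?_, h2, h3⟩
        cases j with
        | zero => exact ⟨hh, _, hq⟩
        | succ j => exact h1 j (by omega)
  obtain ⟨k, hk, h1, h2, r', h3⟩ := key r start hr
  have hhalt : ∀ q, (ofStates enc start read endPass halted output).halted (enc q) = halted q :=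
    fun q => by simp [ofStates, Function.leftInverse_invFun henc q]
  refine ⟨_, (hfinal _ _ h3 h2).2, k, by exact_mod_cast hk, fun j hj => ?_, ?_, fun j hj i _ => ?_,
    ?_, ?_⟩
  · rw [memAfter_ofStates henc, hhalt]
    exact (h1 j hj).1
  · rw [memAfter_ofStates henc, hhalt, h2]
  · rw [memAfter_ofStates henc, memInPass_ofStates henc]
    obtain ⟨h4, r'', h5⟩ := h1 j hj
    exact (hstep _ _ h5 h4).2 i
  · rw [memAfter_ofStates henc]
    exact (hfinal _ _ h3 h2).1
  · rw [memAfter_ofStates henc]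
    simp [ofStates, Function.leftInverse_invFun henc _]

end OfStates

section ComputesWithin

variable {N : StreamingAlgorithm α Out} {σ : List α} {P S : ℕ} {o : Out} {j : ℕ}

theorem ComputesWithin.length_memAfter_le (h : N.ComputesWithin σ P S o)
    (hj : ∀ i < j, N.halted (N.memAfter σ i) = false) : (N.memAfter σ j).length ≤ S := by
  obtain ⟨k, -, h1, h2, h3, h4, -⟩ := h
  rcases lt_trichotomy j k with hjk | rfl | hjk
  · have := h3 j hjk 0 (Nat.zero_le _)
    exact_mod_cast this
  · exact_mod_cast h4
  · simp [hj k hjk] at h2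

theorem ComputesWithin.of_halted (h : N.ComputesWithin σ P S o)
    (hj : ∀ i < j, N.halted (N.memAfter σ i) = false) (hh : N.halted (N.memAfter σ j) = true) :
    j ≤ P ∧ N.output (N.memAfter σ j) = o := by
  obtain ⟨k, hk, h1, h2, -, -, h5⟩ := h
  rcases lt_trichotomy j k with hjk | rfl | hjk
  · simp [h1 j hjk] at hh
  · exact ⟨by exact_mod_cast hk, h5⟩
  · simp [hj k hjk] at h2

/-- If no bit were available, the memory would be empty both now and at the stopping time, so the
stopping decision could not differ. Hence an algorithm that starts a pass needs `1 ≤ S`. -/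
theorem ComputesWithin.of_not_halted (h : N.ComputesWithin σ P S o)
    (hj : ∀ i < j, N.halted (N.memAfter σ i) = false) (hh : N.halted (N.memAfter σ j) = false) :
    j + 1 ≤ P ∧ 1 ≤ S ∧ ∀ i, (N.memInPass σ (N.memAfter σ j) i).length ≤ S := by
  have hlen := h.length_memAfter_le hj
  obtain ⟨k, hk, -, h2, h3, h4, -⟩ := h
  have hjk : j < k := by
    by_contra! hkj
    rcases hkj.lt_or_eq with hkj | rfl
    · simp [hj k hkj] at h2
    · simp [h2] at hh
  refine ⟨hjk.trans_le (by exact_mod_cast hk), ?_, fun i => ?_⟩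
  · by_contra! hS
    have h6 : N.memAfter σ j = [] := List.eq_nil_of_length_eq_zero (by omega)
    have h7 : (N.memAfter σ k).length ≤ S := by exact_mod_cast h4
    have h8 : N.memAfter σ k = [] := List.eq_nil_of_length_eq_zero (by omega)
    rw [h8, ← h6, hh] at h2
    simp at h2
  · rcases le_total i σ.length with hi | hi
    · exact_mod_cast h3 j hjk i hi
    · have := h3 j hjk σ.length le_rfl
      unfold memInPass at this ⊢
      rw [List.take_length] at this
      rw [List.take_of_length_le hi]
      exact_mod_cast this

end ComputesWithin

end StreamingAlgorithm

/-! ### Coding lists of bit strings -/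

/-- A self-delimiting code for lists of bit strings. -/
def codeLists : List (List Bool) → List Bool
  | [] => []
  | x :: h => x.foldr (fun b l => true :: b :: l) (false :: codeLists h)

/-- The decoder for `codeLists`. -/
def decodeLists : List Bool → List (List Bool)
  | [] => []
  | false :: l => [] :: decodeLists l
  | [true] => []
  | true :: b :: l => (decodeLists l).modifyHead (b :: ·)

theorem decodeLists_codeLists (h : List (List Bool)) : decodeLists (codeLists h) = h := by
  induction h with
  | nil => rfl
  | cons x h ih =>
    induction x with
    | nil => simp [codeLists, decodeLists, ih]
    | cons b x ihx =>
      simp only [codeLists] at ihx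
      simp [codeLists, decodeLists, ihx]

theorem codeLists_injective : Function.Injective codeLists :=
  Function.LeftInverse.injective decodeLists_codeLists

theorem codeLists_cons_ne_nil (x : List Bool) (h : List (List Bool)) :
    codeLists (x :: h) ≠ [] := by
  cases x <;> simp [codeLists]

theorem length_codeLists_le {S : ℕ} {h : List (List Bool)} (hS : ∀ x ∈ h, x.length ≤ S) :
    (codeLists h).length ≤ h.length * (2 * S + 1) := by
  have hx : ∀ (x l : List Bool), (x.foldr (fun b l => true :: b :: l) l).length =
      2 * x.length + l.length := fun x l => by
    induction x with
    | nil => simp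
    | cons b x ih => simp [ih]; ring
  induction h with
  | nil => simp [codeLists]
  | cons x h ih =>
    have h1 := ih fun y hy => hS y (List.mem_cons_of_mem _ hy)
    have h2 := hS x List.mem_cons_self
    simp only [codeLists, hx, List.length_cons]
    nlinarith

open Classical in
/-- A code for nonempty lists of bit strings that maps the list with head `q₀.2` and tail `q₀.1` to
the empty string. -/
noncomputable def pointedCode (q₀ q : List (List Bool) × List Bool) : List Bool :=
  if q = q₀ then [] else codeLists (q.2 :: q.1)

theorem pointedCode_self (q₀ : List (List Bool) × List Bool) : pointedCode q₀ q₀ = [] :=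
  if_pos rfl

theorem pointedCode_injective (q₀ : List (List Bool) × List Bool) :
    Function.Injective (pointedCode q₀) := by
  intro q q' h
  unfold pointedCode at h
  split_ifs at h with h1 h2 h2
  · rw [h1, h2]
  · exact absurd h.symm (codeLists_cons_ne_nil _ _)
  · exact absurd h (codeLists_cons_ne_nil _ _)
  · have := codeLists_injective h
    simp only [List.cons.injEq] at this
    exact Prod.ext this.2 this.1

theorem length_pointedCode_le {S : ℕ} {q₀ q : List (List Bool) × List Bool}
    (h1 : ∀ x ∈ q.1, x.length ≤ S) (h2 : q.2.length ≤ S) :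
    (pointedCode q₀ q).length ≤ (q.1.length + 1) * (2 * S + 1) := by
  unfold pointedCode
  split_ifs
  · simp
  · exact length_codeLists_le (h := q.2 :: q.1) (by simpa using ⟨h2, h1⟩)

/-! ### Running the oracle repeatedly -/

section Simulation

variable {a b : ℕ}

/-- The sum of the vectors returned in the rounds recorded in a history. A history lists the final
memories of the oracle algorithm in the rounds completed so far, the latest round first. -/
noncomputable def histSum
    (alg : (Fin a → ℝ≥0) → StreamingAlgorithm (Fin a × Fin b) (Fin a → Fin b → ℝ≥0)) (η : ℝ) :
    List (List Bool) → Fin a → Fin b → ℝ≥0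
  | [] => 0
  | x :: h => histSum alg η h + (alg (mwuWeight η h.length (histSum alg η h))).output x

variable (alg : (Fin a → ℝ≥0) → StreamingAlgorithm (Fin a × Fin b) (Fin a → Fin b → ℝ≥0)) (η : ℝ)

/-- The oracle algorithm for the values determined by a history. -/
noncomputable def histAlg (h : List (List Bool)) :
    StreamingAlgorithm (Fin a × Fin b) (Fin a → Fin b → ℝ≥0) :=
  alg (mwuWeight η h.length (histSum alg η h))

open Classical in
/-- Finish at most `k` rounds that are complete, within a total of `T` rounds. -/
noncomputable def advance (T : ℕ) :
    ℕ → List (List Bool) × List Bool → List (List Bool) × List Bool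
  | 0, q => q
  | k + 1, q =>
    if q.1.length < T ∧ (histAlg alg η q.1).halted q.2 = true then
      advance T k (q.2 :: q.1, (histAlg alg η (q.2 :: q.1)).init)
    else q

/-- The initial state of `mwuAlgorithm`. -/
noncomputable def mwuStart (T : ℕ) : List (List Bool) × List Bool :=
  advance alg η T T ([], (histAlg alg η []).init)

/-- Run the oracle algorithm `T` times, with the multiplicative weights determined by the previous
answers; the output is a function of the sum of the answers. -/
noncomputable def mwuAlgorithm {Out : Type} (T : ℕ) (out : (Fin a → Fin b → ℝ≥0) → Out) :
    StreamingAlgorithm (Fin a × Fin b) Out :=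
  -- The start state gets the empty code, so that a run needing no pass uses no memory even when `S
  -- = 0`.
  .ofStates (pointedCode (mwuStart alg η T)) (mwuStart alg η T)
    (fun q e => (q.1, (histAlg alg η q.1).read q.2 e))
    (fun q => advance alg η T T (q.1, (histAlg alg η q.1).endPass q.2))
    (fun q => decide (q.1.length = T)) (fun q => out (histSum alg η q.1))

/-- Every round of the history ended with an answer satisfying `good` and with at most `S` bits. -/
def ValidHist (good : (Fin a → ℝ≥0) → (Fin a → Fin b → ℝ≥0) → Prop) (S : ℕ) :
    List (List Bool) → Prop
  | [] => True
  | x :: h => ValidHist good S h ∧ x.length ≤ S ∧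
      good (mwuWeight η h.length (histSum alg η h)) ((histAlg alg η h).output x)

/-- The second component of the state is a memory of the current run of the oracle algorithm, and at
most `r` passes are left. -/
def OnTrack (good : (Fin a → ℝ≥0) → (Fin a → Fin b → ℝ≥0) → Prop) (S P T : ℕ)
    (σ : List (Fin a × Fin b)) (r : ℕ) (q : List (List Bool) × List Bool) : Prop :=
  ValidHist alg η good S q.1 ∧ q.1.length ≤ T ∧
    ∃ j, q.2 = (histAlg alg η q.1).memAfter σ j ∧
      (∀ i < j, (histAlg alg η q.1).halted ((histAlg alg η q.1).memAfter σ i) = false) ∧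
      (T - q.1.length) * P ≤ r + j

variable {alg η} {good : (Fin a → ℝ≥0) → (Fin a → Fin b → ℝ≥0) → Prop} {S P T : ℕ}
  {σ : List (Fin a × Fin b)}

theorem ValidHist.length_le {h : List (List Bool)} (hh : ValidHist alg η good S h) :
    ∀ x ∈ h, x.length ≤ S := by
  induction h with
  | nil => simp
  | cons x h ih =>
    rintro y hy
    rcases List.mem_cons.1 hy with rfl | hy
    exacts [hh.2.1, ih hh.1 y hy]

variable (hsolve : ∀ lam, ∃ z, good lam z ∧ (alg lam).ComputesWithin σ P S z)

include hsolve

/-- Oracle runs may stop before their first pass, so several rounds can end between two passes. The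
fuel `k` is enough to finish all remaining rounds, so afterwards either all rounds are done or the
current run needs a pass. -/
theorem OnTrack.advance {r k : ℕ} {q : List (List Bool) × List Bool}
    (hq : OnTrack alg η good S P T σ r q) (hk : T ≤ q.1.length + k) :
    OnTrack alg η good S P T σ r (advance alg η T k q) ∧
      ((advance alg η T k q).1.length < T →
        (histAlg alg η (advance alg η T k q).1).halted (advance alg η T k q).2 = false) := by
  induction k generalizing q with
  | zero => exact ⟨hq, fun h => by simp only [_root_.advance] at h; omega⟩
  | succ k ih =>
    unfold _root_.advance
    split_ifs with hc
    · refine ih ?_ (by simp only [List.length_cons]; omega)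
      obtain ⟨hv, hT, j, hj, hjlt, hr⟩ := hq
      obtain ⟨z, hz, hcomp⟩ := hsolve (mwuWeight η q.1.length (histSum alg η q.1))
      have hc2 := hc.2
      rw [hj] at hc2
      obtain ⟨hjP, hout⟩ := hcomp.of_halted hjlt hc2
      refine ⟨⟨hv, ?_, ?_⟩, ?_, 0, rfl, by simp, ?_⟩
      · rw [hj]
        exact hcomp.length_memAfter_le hjlt
      · rw [hj]
        exact hout.symm ▸ hz
      · simp only [List.length_cons]; omega
      · simp only [List.length_cons]
        -- The finished run used `j ≤ P` passes, so dropping its allowance of `P` while resetting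
        -- `j` to 0 keeps the budget valid.
        obtain ⟨m, hm⟩ : ∃ m, T - q.1.length = m + 1 := ⟨T - q.1.length - 1, by omega⟩
        rw [hm] at hr
        rw [show T - (q.1.length + 1) = m by omega]
        nlinarith
    · refine ⟨hq, fun h => ?_⟩
      simpa using fun h' => hc ⟨h, h'⟩

theorem OnTrack.length_le {r : ℕ} {q : List (List Bool) × List Bool}
    (hq : OnTrack alg η good S P T σ r q) : q.2.length ≤ S := by
  obtain ⟨-, -, j, hj, hjlt, -⟩ := hq
  obtain ⟨z, -, hcomp⟩ := hsolve (mwuWeight η q.1.length (histSum alg η q.1))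
  rw [hj]
  exact hcomp.length_memAfter_le hjlt

omit hsolve in
theorem foldl_read_state (l : List (Fin a × Fin b)) (q : List (List Bool) × List Bool) :
    l.foldl (fun q e => (q.1, (histAlg alg η q.1).read q.2 e)) q =
      (q.1, l.foldl (histAlg alg η q.1).read q.2) := by
  induction l generalizing q with
  | nil => rfl
  | cons e l ih => simp [ih]

/-- If the oracle algorithm solves every instance with this graph, then `mwuAlgorithm` runs it `T`
times. -/
theorem mwuAlgorithm_computesWithin {Out : Type} {out : (Fin a → Fin b → ℝ≥0) → Out} {space : ℝ}
    (hspace0 : 0 ≤ space) (hspace : 1 ≤ S → ((T + 1) * (2 * S + 1) : ℕ) ≤ space) :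
    ∃ h, (ValidHist alg η good S h ∧ h.length = T) ∧
      (mwuAlgorithm alg η T out).ComputesWithin σ (T * P : ℕ) space (out (histSum alg η h)) := by
  have hstart := OnTrack.advance (r := T * P) (T := T) (k := T) (q := ([], (histAlg alg η []).init)) hsolve
    ⟨trivial, Nat.zero_le _, 0, rfl, by simp, by simp⟩ (by simp)
  change OnTrack alg η good S P T σ (T * P) (mwuStart alg η T) ∧ _ at hstart
  -- Either all rounds finish without a pass and the memory is empty, or some run starts a pass,
  -- which forces `1 ≤ S`.
  by_cases hT : (mwuStart alg η T).1.length = T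
  · refine ⟨_, ⟨hstart.1.1, hT⟩, 0, by exact_mod_cast Nat.zero_le (T * P), by simp, ?_, by simp, ?_, ?_⟩
    · rw [mwuAlgorithm, StreamingAlgorithm.memAfter_ofStates (pointedCode_injective _)]
      simpa [StreamingAlgorithm.ofStates,
        Function.leftInverse_invFun (pointedCode_injective (mwuStart alg η T)) _] using hT
    · rw [mwuAlgorithm, StreamingAlgorithm.memAfter_ofStates (pointedCode_injective _)]
      simpa [pointedCode_self] using hspace0
    · rw [mwuAlgorithm, StreamingAlgorithm.memAfter_ofStates (pointedCode_injective _)]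
      simp [StreamingAlgorithm.ofStates,
        Function.leftInverse_invFun (pointedCode_injective (mwuStart alg η T)) _]
  have hlt : (mwuStart alg η T).1.length < T := lt_of_le_of_ne hstart.1.2.1 hT
  have hS : 1 ≤ S := by
    obtain ⟨⟨-, -, j, hj, hjlt, -⟩, hnot⟩ := hstart
    obtain ⟨z, -, hcomp⟩ := hsolve
      (mwuWeight η (mwuStart alg η T).1.length (histSum alg η (mwuStart alg η T).1))
    exact (hcomp.of_not_halted hjlt (hj ▸ hnot hlt)).2.1
  have hcode : ∀ q : List (List Bool) × List Bool, ValidHist alg η good S q.1 →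
      q.1.length ≤ T → q.2.length ≤ S →
      ((pointedCode (mwuStart alg η T) q).length : ℝ) ≤ space := fun q h1 h2 h3 => by
    refine le_trans ?_ (hspace hS)
    exact_mod_cast (length_pointedCode_le h1.length_le h3).trans
      (Nat.mul_le_mul_right _ (by omega))
  have := StreamingAlgorithm.ofStates_computesWithin
    (enc := pointedCode (mwuStart alg η T))
    (read := fun q e => (q.1, (histAlg alg η q.1).read q.2 e))
    (endPass := fun q => advance alg η T T (q.1, (histAlg alg η q.1).endPass q.2))
    (halted := fun q => decide (q.1.length = T)) (output := fun q => out (histSum alg η q.1))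
    (pointedCode_injective _) (σ := σ) (space := space)
    (Inv := fun r q => OnTrack alg η good S P T σ r q ∧
      (q.1.length < T → (histAlg alg η q.1).halted q.2 = false))
    (good := fun o => ∃ h, (ValidHist alg η good S h ∧ h.length = T) ∧ o = out (histSum alg η h))
    ?_ ?_ hstart
  · obtain ⟨_, ⟨h, hh, rfl⟩, hcomp⟩ := this
    exact ⟨h, hh, hcomp⟩
  · rintro r q ⟨⟨hv, hqT, j, hj, hjlt, hr⟩, hnot⟩ hh
    have hqlt : q.1.length < T := lt_of_le_of_ne hqT (by simpa using hh)
    obtain ⟨z, -, hcomp⟩ := hsolve (mwuWeight η q.1.length (histSum alg η q.1))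
    obtain ⟨hjP, -, hpass⟩ := hcomp.of_not_halted hjlt (hj ▸ hnot hqlt)
    -- An unfinished round carries a full allowance `P > j`, so the budget gives `r ≥ 1`.
    have hPr : P ≤ (T - q.1.length) * P := Nat.le_mul_of_pos_left _ (by omega)
    refine ⟨⟨r - 1, by omega, ?_⟩, fun i => ?_⟩
    · rw [foldl_read_state]
      refine OnTrack.advance hsolve ⟨hv, hqT, j + 1, ?_, fun i hi => ?_, ?_⟩ (by omega)
      · simp only [StreamingAlgorithm.memAfter, StreamingAlgorithm.memInPass, List.take_length, hj]
      · rcases (Nat.lt_succ_iff.1 hi).lt_or_eq with hi | rfl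
        · exact hjlt i hi
        · exact hj ▸ hnot hqlt
      · simp only
        omega
    · rw [foldl_read_state]
      refine hcode _ hv hqT ?_
      simp only [hj]
      exact hpass i
  · rintro r q ⟨hq, -⟩ hh
    exact ⟨hcode q hq.1 hq.2.1 (hq.length_le hsolve), q.1, ⟨hq.1, by simpa using hh⟩, rfl⟩

end Simulation

/-! ### The reduction -/

section Reduction

variable {a b : ℕ}

/-- The properties that hold for the answers of the oracle. -/
def IsOracleAnswer (E : Finset (Fin a × Fin b)) (w : Fin a → ℕ+) (β d : ℝ) (lam : Fin a → ℝ≥0)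
    (z : Fin a → Fin b → ℝ≥0) : Prop :=
  IsOracleSolution E w lam β z ∧ IsWidthBounded d z

/-- These are the invariants of the summed answers: support in the graph, the norm bound by the
triangle inequality, and the potential bound. -/
theorem ValidHist.properties {E : Finset (Fin a × Fin b)} {w : Fin a → ℕ+} {β d η : ℝ}
    {alg : (Fin a → ℝ≥0) → StreamingAlgorithm (Fin a × Fin b) (Fin a → Fin b → ℝ≥0)} {S : ℕ}
    (hη : 0 ≤ η) (hηd : η * d ≤ 1) {h : List (List Bool)}
    (hh : ValidHist alg η (IsOracleAnswer E w β d) S h) :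
    (∀ c s, (c, s) ∉ E → histSum alg η h c s = 0) ∧
      (∀ p : ℝ, 1 ≤ p → lpNorm p (fracLoad w (histSum alg η h)) ≤
        h.length * (β * optNorm E w p)) ∧
      ∑ c, (mwuWeight η h.length (histSum alg η h) c : ℝ) ≤
        a * Real.exp (h.length * (η ^ 2 * d ^ 2)) := by
  induction h with
  | nil =>
    refine ⟨fun _ _ _ => rfl, fun p hp => ?_, ?_⟩
    · have : fracLoad w (histSum alg η []) = fun _ => 0 := funext fun s => by
        simp [fracLoad, histSum]
      rw [this, lpNorm_zero hp]
      simp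
    · simp [coe_mwuWeight, histSum, cover]
  | cons x h ih =>
    obtain ⟨h1, h2, h3⟩ := ih hh.1
    obtain ⟨-, -, ⟨hz1, hz2, hz3⟩, hz4⟩ := hh
    refine ⟨fun c s hcs => ?_, fun p hp => ?_, ?_⟩
    · have := hz1 c s hcs
      simp only [histSum, Pi.add_apply, h1 c s hcs, zero_add]
      exact this
    · have : fracLoad w (histSum alg η (x :: h)) =
          fun s => fracLoad w (histSum alg η h) s + fracLoad w ((histAlg alg η h).output x) s :=
        funext fun s => fracLoad_add w _ _ s
      rw [this]
      refine (lpNorm_add_le hp _ _).trans ((add_le_add (h2 p hp) (hz3 p hp)).trans (le_of_eq ?_))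
      simp only [List.length_cons]
      push_cast
      ring
    · refine (sum_mwuWeight_succ_le hη hηd hz4 hz2).trans ?_
      refine (mul_le_mul_of_nonneg_left h3 (Real.exp_pos _).le).trans (le_of_eq ?_)
      simp only [List.length_cons]
      push_cast
      rw [mul_left_comm, ← Real.exp_add]
      ring_nf

open Classical in
/-- An assignment obtained by rounding `Z`, scaled so that it covers every client once. -/
noncomputable def roundedAssignment (w : Fin a → ℕ+) (Z : Fin a → Fin b → ℝ≥0) :
    Finset (Fin a × Fin b) :=
  if h : ∃ f, IsRounding (fun c => ((w c : ℕ) : ℝ)) (fun c s => (Z c s : ℝ) / cover Z c) f then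
    graphAssignment h.choose
  else ∅

theorem isAllNormAssignment_roundedAssignment {E : Finset (Fin a × Fin b)} (hE : Feasible E)
    {w : Fin a → ℕ+} {β t : ℝ} (hβ : 0 < β) (ht : 0 < t) {Z : Fin a → Fin b → ℝ≥0}
    (hsupp : ∀ c s, (c, s) ∉ E → Z c s = 0)
    (hnorm : ∀ p : ℝ, 1 ≤ p → lpNorm p (fracLoad w Z) ≤ t * (β * optNorm E w p))
    (hcover : ∀ c, t * (β / (β + 1)) ≤ cover Z c) :
    IsAllNormAssignment E w (β + 2) (roundedAssignment w Z) := by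
  have hpos : ∀ c, 0 < cover Z c := fun c => lt_of_lt_of_le (by positivity) (hcover c)
  have hex : ∃ f, IsRounding (fun c => ((w c : ℕ) : ℝ))
      (fun c s => (Z c s : ℝ) / cover Z c) f :=
    exists_isRounding (fun c => by positivity)
      (fun c s => div_nonneg (Z c s).2 (hpos c).le)
      (fun c => by rw [← Finset.sum_div]; exact div_self (hpos c).ne')
  rw [roundedAssignment, dif_pos hex]
  exact isAllNormAssignment_of_isRounding hE hβ ht hsupp hnorm hcover hex.choose_spec

theorem isAllNormAssignment_of_isEmpty {E : Finset (Fin 0 × Fin b)} (w : Fin 0 → ℕ+) (β : ℝ) :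
    IsAllNormAssignment E w β ∅ := by
  have hload : ∀ A : Finset (Fin 0 × Fin b), load w A = fun _ => 0 := fun A =>
    funext fun s => by simp [load]
  have hA : IsAssignment E ∅ := ⟨by simp, fun c => c.elim0⟩
  refine ⟨hA, fun p hp => ?_⟩
  have h0 : optNorm E w p = 0 := le_antisymm
    ((optNorm_le hA w p).trans_eq (by rw [hload, lpNorm_zero hp])) (optNorm_nonneg _ _ _)
  rw [hload, lpNorm_zero hp, h0, mul_zero]

/-- The number of rounds of the reduction. -/
noncomputable def numRounds (β d : ℝ) (n : ℕ) : ℕ :=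
  ⌈4 * d ^ 2 * (β + 1) ^ 2 * Real.log n⌉₊

theorem numRounds_bounds {β d : ℝ} {n : ℕ} (hβ : 1 ≤ β) (hdβ : 1 ≤ d * β) (hn : 2 ≤ n) :
    4 * d ^ 2 * (β + 1) ^ 2 * Real.log n ≤ numRounds β d n ∧ 1 ≤ numRounds β d n ∧
      (numRounds β d n : ℝ) ≤ 18 * (d ^ 2 * β ^ 2 * Real.log n) := by
  have hd : 0 < d := by
    by_contra! h
    nlinarith
  have hlog : 1 / 2 ≤ Real.log n := by
    have h1 := Real.log_two_gt_d9
    have h2 : Real.log 2 ≤ Real.log n :=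
      Real.log_le_log (by norm_num) (by exact_mod_cast hn)
    linarith
  have hlog0 : 0 < Real.log n := by linarith
  have hone : 1 ≤ d ^ 2 * β ^ 2 := by
    rw [← mul_pow]
    exact one_le_pow₀ hdβ
  have hsq : (β + 1) ^ 2 ≤ 4 * β ^ 2 := by nlinarith
  refine ⟨Nat.le_ceil _, Nat.one_le_ceil_iff.2 (by positivity), ?_⟩
  refine (Nat.ceil_lt_add_one (by positivity)).le.trans ?_
  have h1 : 4 * d ^ 2 * (β + 1) ^ 2 * Real.log n ≤ 16 * (d ^ 2 * β ^ 2 * Real.log n) := by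
    calc 4 * d ^ 2 * (β + 1) ^ 2 * Real.log n
        ≤ 4 * d ^ 2 * (4 * β ^ 2) * Real.log n := by gcongr
      _ = _ := by ring
  -- The 1 lost by rounding up is absorbed as twice this quantity, so 16 becomes 18.
  have h2 : 1 / 2 ≤ d ^ 2 * β ^ 2 * Real.log n := by nlinarith
  linarith

/-- The algorithm of the reduction. -/
noncomputable def reductionAlgorithm (O : OracleAlgorithm) (β d : ℕ → ℝ) : AssignmentAlgorithm
  -- Without clients nothing forces `1 ≤ β`, and n may be 0 or 1, making log n zero; the empty
  -- assignment is output without a pass.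
  | 0, _, _ => ⟨[], fun _ _ => [], fun _ => [], fun _ => true, fun _ => ∅⟩
  | a + 1, b, w =>
    mwuAlgorithm (O (a + 1) b w)
      (1 / (β (a + 1 + b) + 1) / (2 * d (a + 1 + b) ^ 2))
      (numRounds (β (a + 1 + b)) (d (a + 1 + b)) (a + 1 + b)) (roundedAssignment w)

end Reduction

theorem StreamingAlgorithm.ComputesWithin.mono {α Out : Type} {M : StreamingAlgorithm α Out}
    {σ : List α} {passes passes' space space' : ℝ} {o : Out}
    (h : M.ComputesWithin σ passes space o) (hp : passes ≤ passes') (hs : space ≤ space') :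
    M.ComputesWithin σ passes' space' o := by
  obtain ⟨k, h1, h2, h3, h4, h5, h6⟩ := h
  exact ⟨k, h1.trans hp, h2, h3, fun j hj i hi => (h4 j hj i hi).trans hs, h5.trans hs, h6⟩

theorem mainTheorem2 :
    ∃ K : ℝ, 0 < K ∧
      ∀ (β d : ℕ → ℝ) (p S : ℕ → ℕ → ℕ),
        (∀ n, 1 ≤ d n * β n) →
        (∃ O : OracleAlgorithm, O.Solves β d (fun n m => (p n m : ℝ)) (fun n m => (S n m : ℝ))) →
        ∃ M : AssignmentAlgorithm,
          M.Solves (fun n => β n + 2)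
            (fun n m => K * ((p n m : ℝ) * (d n) ^ 2 * (β n) ^ 2 * Real.log n))
            (fun n m => K * ((S n m : ℝ) * (β n) ^ 2 * (d n) ^ 2 * Real.log n + n)) := by
  -- The constant is 18 · 6: T ≤ 18·d²β² log n, and (T+1)(2S+1) ≤ 6TS once T, S ≥ 1.
  refine ⟨108, by norm_num, fun β d p S hdβ ⟨O, hO⟩ => ⟨reductionAlgorithm O β d, ?_⟩⟩
  intro a b w E σ hE hσ
  have hlog : ∀ n : ℕ, 0 ≤ Real.log n := fun n => Real.log_natCast_nonneg n
  have hspace0 : ∀ n m, 0 ≤ 108 * ((S n m : ℝ) * (β n) ^ 2 * (d n) ^ 2 * Real.log n + n) :=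
    fun n m => by have := hlog n; positivity
  have hpasses0 : ∀ n m, 0 ≤ 108 * ((p n m : ℝ) * (d n) ^ 2 * (β n) ^ 2 * Real.log n) :=
    fun n m => by have := hlog n; positivity
  cases a with
  | zero =>
    exact ⟨∅, isAllNormAssignment_of_isEmpty w _, 0, by simpa using hpasses0 _ _, by simp, rfl,
      by simp, by simpa [StreamingAlgorithm.memAfter, reductionAlgorithm] using hspace0 _ _, rfl⟩
  | succ a =>
    obtain ⟨s₀, -⟩ := hE 0
    have hn : 2 ≤ a + 1 + b := by have := s₀.pos; omega
    have hdβn := hdβ (a + 1 + b)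
    -- That the oracle can answer λ = w forces this bound; with `d * β ≥ 1` it makes d positive.
    have hβ : 1 ≤ β (a + 1 + b) := by
      obtain ⟨z, hz, -⟩ := hO (a + 1) b w (fun c => ((w c : ℕ) : ℝ≥0)) E σ hE hσ
      exact one_le_of_isOracleSolution hE hz
    have hsolve : ∀ lam, ∃ z, IsOracleAnswer E w (β (a + 1 + b)) (d (a + 1 + b)) lam z ∧
        (O (a + 1) b w lam).ComputesWithin σ (p (a + 1 + b) E.card) (S (a + 1 + b) E.card) z :=
      fun lam => by
        obtain ⟨z, h1, h2, h3⟩ := hO (a + 1) b w lam E σ hE hσ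
        exact ⟨z, ⟨h1, h2⟩, h3⟩
    have hspace0n := hspace0 (a + 1 + b) E.card
    have hlogn := hlog (a + 1 + b)
    have han : a + 1 ≤ a + 1 + b := Nat.le_add_right _ _
    simp only [reductionAlgorithm]
    generalize a + 1 + b = n at *
    generalize β n = β at *
    generalize d n = d at *
    generalize p n E.card = p at *
    generalize S n E.card = S at *
    obtain ⟨hT1, hT2, hT3⟩ := numRounds_bounds hβ hdβn hn
    generalize numRounds β d n = T at *
    have hd : 0 < d := by
      by_contra! h
      nlinarith
    have hη0 : 0 ≤ 1 / (β + 1) / (2 * d ^ 2) := by positivity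
    have hηd : 1 / (β + 1) / (2 * d ^ 2) * d ≤ 1 := by
      rw [div_div, div_mul_eq_mul_div, one_mul, div_le_one (by positivity)]
      nlinarith
    have hT2' : (1 : ℝ) ≤ T := by exact_mod_cast hT2
    obtain ⟨h, ⟨hv, hlen⟩, hcomp⟩ := mwuAlgorithm_computesWithin
      (η := 1 / (β + 1) / (2 * d ^ 2)) (T := T) (out := roundedAssignment w) hsolve hspace0n
      (fun hS => by
        have hS' : (1 : ℝ) ≤ S := by exact_mod_cast hS
        push_cast
        calc ((T : ℝ) + 1) * (2 * S + 1) ≤ (T + T) * (2 * S + S) := by gcongr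
          _ = T * (6 * S) := by ring
          _ ≤ 18 * (d ^ 2 * β ^ 2 * Real.log n) * (6 * S) := by gcongr
          _ = 108 * (S * β ^ 2 * d ^ 2 * Real.log n) := by ring
          _ ≤ _ := by
            gcongr
            exact le_add_of_nonneg_right (Nat.cast_nonneg n))
    obtain ⟨h1, h2, h3⟩ := hv.properties hη0 hηd
    rw [hlen] at h2 h3
    refine ⟨_, isAllNormAssignment_roundedAssignment hE (by linarith) (by linarith) h1 h2
      (fun c => ?_), hcomp.mono ?_ le_rfl⟩
    · have hε : 1 - 1 / (β + 1) = β / (β + 1) := by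
        field_simp
        ring
      rw [← hε]
      refine cover_ge_of_sum_mwuWeight_le hd (by positivity) han h3 ?_ c
      rw [div_pow, one_pow, mul_one_div, le_div_iff₀ (by positivity)]
      linarith
    · push_cast
      calc (T : ℝ) * p ≤ 18 * (d ^ 2 * β ^ 2 * Real.log n) * p := by gcongr
        _ = 18 * (p * d ^ 2 * β ^ 2 * Real.log n) := by ring
        _ ≤ _ := by
          gcongr
          norm_num
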